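/- Let $\mathcal D_1=\{z\in\mathbb C:|z|<1\}$ and $$SU(1,1)=\Big\{\begin{pmatrix}a&b\\ \bar b&\bar a\end{pmatrix}: |a|^2-|b|^2=1\Big\}.$$ Parametrize by pairs $\tilde g=(\gamma,\omega)\in\mathcal D_1\times\mathbb R$ and put $$a=e^{i\omega}(1-|\gamma|^2)^{-1/2},\qquad b=e^{i\omega}\gamma(1-|\gamma|^2)^{-1/2}.$$ With the product topology and the multiplication $(\gamma_1,\omega_1)(\gamma_2,\omega_2)=(\gamma,\omega)$, $$c=1+\gamma_1\bar\gamma_2e^{-2i\omega_2},\qquad \gamma=\frac{\gamma_2+\gamma_1e^{-2i\omega_2}}{c},\qquad \omega=\omega_1+\omega_2+\arg c\quad(|\arg c|<\pi/2),$$ $\mathcal D_1\times\mathbb R$ is a simply connected topological group, and $(\gamma,\omega)\mapsto\begin{pmatrix}a&b\\ \bar b&\bar a\end{pmatrix}$ is a surjective homomorphism onto $SU(1,1)$ (with matrix multiplication) and a covering map; that is, it is the universal covering group $\widetilde{SU(1,1)}$. Let $0<k<1/2$ be real, and let $\mathcal H_k$ be the Hilbert space of the holomorphic functions $f(z)=\sum_{n\ge0}a_nz^n$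 on $\mathcal D_1$ with $$\|f\|_k^2=\sum_{n\ge0}\frac{\Gamma(2k)\,n!}{\Gamma(2k+n)}|a_n|^2<\infty,$$ with the corresponding scalar product $(f,h)_k=\sum_{n\ge 0}\frac{\Gamma(2k)\,n!}{\Gamma(2k+n)}\bar a_nb_n$ for $f=\sum a_nz^n$, $h=\sum b_nz^n$. For $\tilde g=(\gamma,\omega)$ put $$[T(\tilde g)_kf](z)=e^{2ik\omega}(1-|\gamma|^2)^k(1+\bar\gamma z)^{-2k}f\Big(\frac{az+b}{\bar bz+\bar a}\Big),$$ with the principal branch of the power. Then every $T(\tilde g)_k$ is a unitary operator of $\mathcal H_k$ onto itself, with $T(1)_k=1$, $$T(\tilde g_1\tilde g_2)_k=T(\tilde g_2)_kT(\tilde g_1)_k,\qquad (T(\tilde g)_kf_1,f_2)_k=(f_1,T(\tilde g^{-1})_kf_2)_k ,$$ so that $\tilde g\mapsto T(\tilde g)_k$ is a unitary representation of the opposite group of $\widetilde{SU(1,1)}$ (it acts by right translation); this representation is strongly continuous and irreducible. Consequently, with $\tilde g^{t}=(e^{-2i\omega}\bar\gamma,\omega)$ the lift of the transposition of matrices, $\tilde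 g\mapsto T(\tilde g^{t})_k$ is a strongly continuous irreducible unitary representation of $\widetilde{SU(1,1)}$ on $\mathcal H_k$. (Irreducible: the space is nonzero and its only closed invariant subspaces are $0$ and the whole space.) -/

import Mathlib

open Complex
open scoped ComplexConjugate Complex.UnitDisc

noncomputable section

/-! ### The group `SU(1,1)` -/

/-- `SU(1,1)`: the complex matrices `!![a, b; conj b, conj a]` of determinant `1`,
with the topology inherited from the space of matrices. -/
def SU11 : Subgroup (Matrix.SpecialLinearGroup (Fin 2) ℂ) where
  carrier := {g | g.1 1 0 = conj (g.1 0 1) ∧ g.1 1 1 = conj (g.1 0 0)}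
  one_mem' := by simp
  mul_mem' := by
    rintro g h ⟨h1, h2⟩ ⟨h3, h4⟩
    simp only [Set.mem_ofPred_eq, Matrix.SpecialLinearGroup.coe_mul, Matrix.mul_apply,
      Fin.sum_univ_two, h1, h2, h3, h4, map_add, map_mul, Complex.conj_conj]
    constructor <;> ring
  inv_mem' := by
    rintro g ⟨h1, h2⟩
    simp only [Set.mem_ofPred_eq, Matrix.SpecialLinearGroup.coe_inv, Matrix.adjugate_fin_two,
      Matrix.of_apply, Matrix.cons_val', Matrix.cons_val_zero, Matrix.cons_val_one,
      Matrix.cons_val_fin_one, h1, h2, map_neg, Complex.conj_conj]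
    simp

/-! ### The universal covering group of `SU(1,1)` in the coordinates `(γ, ω)` -/

/-- The points `(γ, ω)` with `|γ| < 1` and `ω` real. -/
@[ext]
structure SU11Cover where
  γ : 𝔻
  ω : ℝ

namespace SU11Cover

instance : TopologicalSpace SU11Cover :=
  TopologicalSpace.induced (fun g => (g.γ, g.ω)) inferInstance

/-- `a = e^{iω} (1 - |γ|²)^{-1/2}`. -/
def a (g : SU11Cover) : ℂ :=
  exp (I * g.ω) * ((1 - ‖(g.γ : ℂ)‖ ^ 2) ^ (-(1 / 2) : ℝ) : ℝ)

/-- `b = e^{iω} γ (1 - |γ|²)^{-1/2}`. -/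
def b (g : SU11Cover) : ℂ :=
  exp (I * g.ω) * g.γ * ((1 - ‖(g.γ : ℂ)‖ ^ 2) ^ (-(1 / 2) : ℝ) : ℝ)

/-- The complex number `1 + γ₁ conj γ₂ e^{-2iω₂}`, which lies in the right half-plane. -/
def cocycle (g h : SU11Cover) : ℂ :=
  1 + g.γ * conj (h.γ : ℂ) * exp (-2 * I * h.ω)

theorem one_sub_pos (z : 𝔻) : 0 < 1 - ‖(z : ℂ)‖ ^ 2 := by
  have := z.sq_norm_lt_one
  linarith

theorem b_eq (g : SU11Cover) : g.b = g.a * g.γ := by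
  simp only [a, b]; ring

theorem norm_exp_I (x : ℝ) : ‖exp (I * x)‖ = 1 := by
  rw [mul_comm]; exact norm_exp_ofReal_mul_I x

theorem norm_exp_two (x : ℝ) : ‖exp (-2 * I * x)‖ = 1 := by
  have : (-2 * I * x : ℂ) = ((-2 * x : ℝ) : ℂ) * I := by push_cast; ring
  rw [this]; exact norm_exp_ofReal_mul_I _

theorem norm_a_sq (g : SU11Cover) : ‖g.a‖ ^ 2 = (1 - ‖(g.γ : ℂ)‖ ^ 2)⁻¹ := by
  have h := one_sub_pos g.γ
  rw [a, norm_mul, norm_exp_I, one_mul, Complex.norm_real, Real.norm_eq_abs, sq_abs,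
    ← Real.rpow_natCast, ← Real.rpow_mul h.le]
  norm_num
  exact Real.rpow_neg_one _

theorem a_ne_zero (g : SU11Cover) : g.a ≠ 0 := by
  have h := one_sub_pos g.γ
  have h2 := norm_a_sq g
  intro h0
  rw [h0] at h2
  have : (0 : ℝ) < (1 - ‖(g.γ : ℂ)‖ ^ 2)⁻¹ := inv_pos.2 h
  simp at h2
  linarith

theorem mul_conj_eq (z : ℂ) : z * conj z = ((‖z‖ ^ 2 : ℝ) : ℂ) := by
  rw [Complex.mul_conj, Complex.normSq_eq_norm_sq]

theorem a_b_det (g : SU11Cover) : g.a * conj g.a - g.b * conj g.b = 1 := by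
  have h := one_sub_pos g.γ
  have h2 := norm_a_sq g
  have h3 : ‖g.a‖ ^ 2 - ‖g.b‖ ^ 2 = 1 := by
    rw [b_eq, norm_mul, mul_pow, h2]
    field_simp
  rw [mul_conj_eq, mul_conj_eq, ← Complex.ofReal_sub, h3, Complex.ofReal_one]

theorem one_add_ne_zero {z : ℂ} (hz : ‖z‖ < 1) : 1 + z ≠ 0 := by
  intro h
  have : z = -1 := by linear_combination h
  simp [this] at hz

theorem arg_one_add {z : ℂ} (hz : ‖z‖ < 1) : |arg (1 + z)| < Real.pi / 2 := by
  rw [Complex.abs_arg_lt_pi_div_two_iff]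
  left
  have := (abs_lt.1 ((Complex.abs_re_le_norm z).trans_lt hz)).1
  simp
  linarith

theorem norm_sq_identity (u v : ℂ) :
    ‖1 + u * conj v‖ ^ 2 - ‖v + u‖ ^ 2 = (1 - ‖u‖ ^ 2) * (1 - ‖v‖ ^ 2) := by
  apply Complex.ofReal_injective
  simp only [Complex.ofReal_sub, Complex.ofReal_mul, ← mul_conj_eq, map_add, map_mul, map_one,
    Complex.conj_conj, Complex.ofReal_one]
  ring

theorem norm_mul_conj_lt {u v : ℂ} (hu : ‖u‖ < 1) (hv : ‖v‖ < 1) : ‖u * conj v‖ < 1 := by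
  rw [norm_mul, Complex.norm_conj]
  exact mul_lt_one_of_nonneg_of_lt_one_left (norm_nonneg _) hu hv.le

theorem norm_div_lt {u v : ℂ} (hu : ‖u‖ < 1) (hv : ‖v‖ < 1) :
    ‖(v + u) / (1 + u * conj v)‖ < 1 := by
  have h1 := norm_sq_identity u v
  have h2 : 0 < (1 - ‖u‖ ^ 2) * (1 - ‖v‖ ^ 2) := by
    apply mul_pos <;> nlinarith [norm_nonneg u, norm_nonneg v]
  have h3 : 0 < ‖1 + u * conj v‖ := norm_pos_iff.2 (one_add_ne_zero (norm_mul_conj_lt hu hv))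
  rw [norm_div, div_lt_one h3]
  exact lt_of_pow_lt_pow_left₀ 2 h3.le (by linarith)

theorem norm_rot (g h : SU11Cover) : ‖(g.γ : ℂ) * exp (-2 * I * h.ω)‖ < 1 := by
  rw [norm_mul, norm_exp_two, mul_one]
  exact g.γ.norm_lt_one

theorem cocycle_eq (g h : SU11Cover) :
    cocycle g h = 1 + (g.γ : ℂ) * exp (-2 * I * h.ω) * conj (h.γ : ℂ) := by
  rw [cocycle]; ring

theorem cocycle_ne_zero (g h : SU11Cover) : cocycle g h ≠ 0 := by
  rw [cocycle_eq]
  exact one_add_ne_zero (norm_mul_conj_lt (norm_rot g h) h.γ.norm_lt_one)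

theorem abs_arg_cocycle (g h : SU11Cover) : |arg (cocycle g h)| < Real.pi / 2 := by
  rw [cocycle_eq]
  exact arg_one_add (norm_mul_conj_lt (norm_rot g h) h.γ.norm_lt_one)

/-- The group law: the lift of matrix multiplication to the coordinates `(γ, ω)`. -/
instance : Mul SU11Cover where
  mul g h :=
    { γ := .mk ((h.γ + g.γ * exp (-2 * I * h.ω)) / cocycle g h) (by
        rw [cocycle_eq]
        exact norm_div_lt (norm_rot g h) h.γ.norm_lt_one)
      ω := g.ω + h.ω + arg (cocycle g h) }

instance : One SU11Cover where
  one := { γ := 0, ω := 0 }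

instance : Inv SU11Cover where
  inv g :=
    { γ := .mk (-exp (2 * I * g.ω) * g.γ) (by
        have h : ‖exp (2 * I * g.ω)‖ = 1 := by
          have : (2 * I * g.ω : ℂ) = -2 * I * ((-g.ω : ℝ) : ℂ) := by push_cast; ring
          rw [this, norm_exp_two]
        rw [norm_mul, norm_neg, h, one_mul]
        exact g.γ.norm_lt_one)
      ω := -g.ω }

theorem mul_γ (g h : SU11Cover) :
    ((g * h).γ : ℂ) = (h.γ + g.γ * exp (-2 * I * h.ω)) / cocycle g h := rfl

theorem mul_ω (g h : SU11Cover) : (g * h).ω = g.ω + h.ω + arg (cocycle g h) := rfl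

theorem one_γ : ((1 : SU11Cover).γ : ℂ) = 0 := rfl

theorem one_ω : (1 : SU11Cover).ω = 0 := rfl

theorem inv_γ (g : SU11Cover) : ((g⁻¹).γ : ℂ) = -exp (2 * I * g.ω) * g.γ := rfl

theorem inv_ω (g : SU11Cover) : (g⁻¹).ω = -g.ω := rfl

theorem conj_exp_I (x : ℝ) : conj (exp (I * x)) = exp (-(I * x)) := by
  rw [← Complex.exp_conj, map_mul, Complex.conj_I, Complex.conj_ofReal, neg_mul]

theorem conj_a (g : SU11Cover) : conj g.a = exp (-2 * I * g.ω) * g.a := by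
  rw [a, map_mul, Complex.conj_ofReal, conj_exp_I, ← mul_assoc, ← Complex.exp_add]
  congr 2
  ring

theorem a_mul' (g h : SU11Cover) : (g * h).a = g.a * h.a * cocycle g h := by
  have hg := one_sub_pos g.γ
  have hh := one_sub_pos h.γ
  have hc := norm_pos_iff.2 (cocycle_ne_zero g h)
  have key : 1 - ‖((g * h).γ : ℂ)‖ ^ 2
      = (1 - ‖(g.γ : ℂ)‖ ^ 2) * (1 - ‖(h.γ : ℂ)‖ ^ 2) * ‖cocycle g h‖ ^ (-2 : ℝ) := by
    have h1 := norm_sq_identity ((g.γ : ℂ) * exp (-2 * I * h.ω)) h.γ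
    rw [← cocycle_eq, norm_mul (g.γ : ℂ), norm_exp_two, mul_one] at h1
    rw [← h1, mul_γ, norm_div, Real.rpow_neg hc.le]
    norm_num
    field_simp
  have key2 : (1 - ‖((g * h).γ : ℂ)‖ ^ 2) ^ (-(1 / 2) : ℝ)
      = (1 - ‖(g.γ : ℂ)‖ ^ 2) ^ (-(1 / 2) : ℝ) * (1 - ‖(h.γ : ℂ)‖ ^ 2) ^ (-(1 / 2) : ℝ)
        * ‖cocycle g h‖ := by
    rw [key, Real.mul_rpow (by positivity) (by positivity), Real.mul_rpow hg.le hh.le,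
      ← Real.rpow_mul hc.le]
    norm_num
  have key3 : cocycle g h = ‖cocycle g h‖ * exp (I * arg (cocycle g h)) := by
    rw [mul_comm I]; exact (Complex.norm_mul_exp_arg_mul_I _).symm
  rw [a, key2, mul_ω, a, a]
  conv_rhs => rw [key3]
  push_cast
  rw [mul_add, mul_add, Complex.exp_add, Complex.exp_add]
  ring

theorem a_mul (g h : SU11Cover) : (g * h).a = g.a * h.a + g.b * conj h.b := by
  rw [a_mul', b_eq, b_eq, map_mul, conj_a, cocycle]
  ring

theorem b_mul (g h : SU11Cover) : (g * h).b = g.a * h.b + g.b * conj h.a := by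
  have hc := cocycle_ne_zero g h
  rw [b_eq (g * h), a_mul', b_eq, b_eq, conj_a, mul_γ]
  field_simp

theorem ext_a {g h : SU11Cover} (ha : g.a = h.a) (hb : g.b = h.b) (hω : g.ω = h.ω) : g = h := by
  apply SU11Cover.ext _ hω
  apply Complex.UnitDisc.coe_injective
  rw [b_eq, b_eq, ha] at hb
  exact mul_left_cancel₀ (a_ne_zero h) hb

theorem arg_mul_cocycle {z w : ℂ} (hz : z ≠ 0) (hw : w ≠ 0) (h1 : |arg z| < Real.pi / 2)
    (h2 : |arg w| < Real.pi / 2) : arg (z * w) = arg z + arg w := by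
  rw [Complex.arg_mul_eq_add_arg_iff hz hw]
  rw [abs_lt] at h1 h2
  constructor <;> linarith [h1.1, h1.2, h2.1, h2.2]

instance : Group SU11Cover :=
  Group.ofLeftAxioms
    (by
      intro g h k
      have e : cocycle g h * cocycle (g * h) k = cocycle h k * cocycle g (h * k) := by
        have h0 : g.a * h.a * k.a ≠ 0 :=
          mul_ne_zero (mul_ne_zero (a_ne_zero g) (a_ne_zero h)) (a_ne_zero k)
        have h1 : (g * h * k).a = g.a * h.a * k.a * (cocycle g h * cocycle (g * h) k) := by
          rw [a_mul', a_mul']; ring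
        have h2 : (g * (h * k)).a = g.a * h.a * k.a * (cocycle h k * cocycle g (h * k)) := by
          rw [a_mul', a_mul']; ring
        have h3 : (g * h * k).a = (g * (h * k)).a := by
          rw [a_mul, a_mul, b_mul, a_mul, a_mul, b_mul]
          simp only [map_add, map_mul, Complex.conj_conj]
          ring
        exact mul_left_cancel₀ h0 (by rw [← h1, ← h2, h3])
      apply ext_a
      · rw [a_mul, a_mul, b_mul, a_mul, a_mul, b_mul]
        simp only [map_add, map_mul, Complex.conj_conj]
        ring
      · rw [b_mul, a_mul, b_mul, b_mul, b_mul, a_mul]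
        simp only [map_add, map_mul, Complex.conj_conj]
        ring
      · have e2 := congrArg arg e
        rw [arg_mul_cocycle (cocycle_ne_zero _ _) (cocycle_ne_zero _ _) (abs_arg_cocycle _ _)
            (abs_arg_cocycle _ _),
          arg_mul_cocycle (cocycle_ne_zero _ _) (cocycle_ne_zero _ _) (abs_arg_cocycle _ _)
            (abs_arg_cocycle _ _)] at e2
        rw [mul_ω, mul_ω, mul_ω, mul_ω]
        linarith)
    (by
      intro g
      apply SU11Cover.ext
      · apply Complex.UnitDisc.coe_injective
        simp [mul_γ, cocycle, one_γ]
      · simp [mul_ω, cocycle, one_γ, one_ω])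
    (by
      intro g
      have e : exp (2 * I * g.ω) * exp (-2 * I * g.ω) = 1 := by
        rw [← Complex.exp_add]; ring_nf; simp
      have hc : cocycle g⁻¹ g = ((1 - ‖(g.γ : ℂ)‖ ^ 2 : ℝ) : ℂ) := by
        rw [cocycle, inv_γ, Complex.ofReal_sub, ← mul_conj_eq, Complex.ofReal_one]
        linear_combination (-(g.γ : ℂ) * conj (g.γ : ℂ)) * e
      apply SU11Cover.ext
      · apply Complex.UnitDisc.coe_injective
        rw [mul_γ, one_γ, inv_γ]
        have : (g.γ : ℂ) + -exp (2 * I * g.ω) * g.γ * exp (-2 * I * g.ω) = 0 := by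
          linear_combination (-(g.γ : ℂ)) * e
        rw [this, zero_div]
      · rw [mul_ω, hc, Complex.arg_ofReal_of_nonneg (one_sub_pos _).le, inv_ω, one_ω]
        ring)

theorem a_one : (1 : SU11Cover).a = 1 := by simp [a, one_γ, one_ω]

theorem b_one : (1 : SU11Cover).b = 0 := by simp [b, one_γ]

/-- The covering homomorphism `(γ, ω) ↦ !![a, b; conj b, conj a]`. -/
def proj : SU11Cover →* SU11 where
  toFun g := ⟨⟨!![g.a, g.b; conj g.b, conj g.a], by
    rw [Matrix.det_fin_two_of]; exact a_b_det g⟩, by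
      change _ = _ ∧ _ = _
      simp⟩
  map_one' := by
    apply Subtype.ext
    apply Subtype.ext
    ext i j
    fin_cases i <;> fin_cases j <;> simp [a_one, b_one]
  map_mul' g h := by
    apply Subtype.ext
    apply Subtype.ext
    ext i j
    change !![(g * h).a, (g * h).b; conj (g * h).b, conj (g * h).a] i j
      = (!![g.a, g.b; conj g.b, conj g.a] * !![h.a, h.b; conj h.b, conj h.a]) i j
    fin_cases i <;> fin_cases j <;>
      simp [a_mul, b_mul, Matrix.mul_apply, Fin.sum_univ_two] <;> ring

/-- The lift of the transposition of matrices: `b` is replaced by `conj b`, and `a`, `ω` are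
unchanged. -/
def transpose (g : SU11Cover) : SU11Cover where
  γ := .mk (exp (-2 * I * g.ω) * conj (g.γ : ℂ)) (by
    rw [norm_mul, norm_exp_two, one_mul, Complex.norm_conj]
    exact g.γ.norm_lt_one)
  ω := g.ω

theorem coe_proj_transpose (g : SU11Cover) :
    (proj (transpose g)).1.1 = (proj g).1.1.transpose := by
  have hγ : ((transpose g).γ : ℂ) = exp (-2 * I * g.ω) * conj (g.γ : ℂ) := rfl
  have hn : ‖((transpose g).γ : ℂ)‖ = ‖(g.γ : ℂ)‖ := by
    rw [hγ, norm_mul, norm_exp_two, one_mul, Complex.norm_conj]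
  have ha : (transpose g).a = g.a := by
    rw [a, a, hn]; rfl
  have hb : (transpose g).b = conj g.b := by
    rw [b_eq, ha, b_eq, map_mul, conj_a, hγ]; ring
  ext i j
  fin_cases i <;> fin_cases j <;> simp [proj, ha, hb]

/-- The action `z ↦ (a z + b) / (conj b z + conj a)` on the unit disc. -/
def moebius (g : SU11Cover) (z : 𝔻) : 𝔻 :=
  .mk ((g.a * z + g.b) / (conj g.b * z + conj g.a)) (by
    have h0 := a_ne_zero g
    have h0' : conj g.a ≠ 0 := by simpa using h0
    have h1 : ‖(z + g.γ : ℂ) / (1 + z * conj (g.γ : ℂ))‖ < 1 := by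
      rw [add_comm (z : ℂ)]
      exact norm_div_lt z.norm_lt_one g.γ.norm_lt_one
    have h2 : (g.a * z + g.b) / (conj g.b * z + conj g.a)
        = g.a / conj g.a * ((z + g.γ : ℂ) / (1 + z * conj (g.γ : ℂ))) := by
      rw [b_eq, map_mul, div_mul_div_comm]
      congr 1 <;> ring
    rw [h2, norm_mul, norm_div, Complex.norm_conj, div_self (norm_ne_zero_iff.2 h0), one_mul]
    exact h1)

end SU11Cover

/-! ### The Hilbert space of holomorphic functions on the unit disc -/

/-- The parameter range `0 < k < 1/2`. -/
abbrev Param : Type := Set.Ioo (0 : ℝ) (1 / 2)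

/-- The weight `Γ(2k) Γ(n+1) / Γ(2k+n)`. -/
def weight (k : Param) (n : ℕ) : ℝ :=
  Real.Gamma (2 * k) * Real.Gamma (n + 1) / Real.Gamma (2 * k + n)

theorem weight_pos (k : Param) (n : ℕ) : 0 < weight k n := by
  have h := k.2.1
  unfold weight
  have h1 := Real.Gamma_pos_of_pos (s := 2 * k) (by linarith)
  have h2 := Real.Gamma_pos_of_pos (s := (n : ℝ) + 1) (by positivity)
  have h3 := Real.Gamma_pos_of_pos (s := 2 * (k : ℝ) + n) (by positivity)
  positivity

theorem weight_ge_one (k : Param) (n : ℕ) : 1 ≤ weight k n := by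
  have hk := k.2.1
  have hk2 := k.2.2
  induction n with
  | zero =>
    have h1 := Real.Gamma_pos_of_pos (s := 2 * k) (by linarith)
    simp [weight, h1.ne']
  | succ n ih =>
    have h0 : (0 : ℝ) < 2 * k + n := by positivity
    have e : weight k (n + 1) = weight k n * ((n + 1) / (2 * k + n)) := by
      have h2 : Real.Gamma (((n + 1 : ℕ) : ℝ) + 1) = (n + 1) * Real.Gamma (n + 1) := by
        push_cast
        exact Real.Gamma_add_one (by positivity)
      have h3 : Real.Gamma (2 * k + ((n + 1 : ℕ) : ℝ)) = (2 * k + n) * Real.Gamma (2 * k + n) := by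
        push_cast
        rw [← add_assoc]
        exact Real.Gamma_add_one h0.ne'
      rw [weight, h2, h3, weight]
      field_simp
    rw [e]
    have : 1 ≤ ((n : ℝ) + 1) / (2 * k + n) := by
      rw [one_le_div h0]; linarith
    nlinarith

/-- `f(z) = ∑ aₙ zⁿ` on the whole unit disc. -/
def HasTaylor (f : 𝔻 → ℂ) (a : ℕ → ℂ) : Prop :=
  ∀ z : 𝔻, HasSum (fun n : ℕ => a n * (z : ℂ) ^ n) (f z)

theorem HasTaylor.unique {f : 𝔻 → ℂ} {a b : ℕ → ℂ} (ha : HasTaylor f a) (hb : HasTaylor f b) :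
    a = b := by
  classical
  let F : ℂ → ℂ := fun z => if h : ‖z‖ < 1 then f (.mk z h) else 0
  have key : ∀ c : ℕ → ℂ, HasTaylor f c →
      HasFPowerSeriesAt F (FormalMultilinearSeries.ofScalars ℂ c) 0 := by
    intro c hc
    rw [hasFPowerSeriesAt_iff]
    filter_upwards [Metric.ball_mem_nhds (0 : ℂ) one_pos] with z hz
    have hz' : ‖z‖ < 1 := by simpa using hz
    have := hc (.mk z hz')
    simpa [F, hz', mul_comm, FormalMultilinearSeries.coeff_ofScalars] using this
  have := (key a ha).eq_formalMultilinearSeries (key b hb)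
  exact FormalMultilinearSeries.ofScalars_series_injective ℂ ℂ this

/-- The functions `f(z) = ∑ aₙ zⁿ`, holomorphic on the unit disc, with
`∑ Γ(2k) Γ(n+1) / Γ(2k+n) |aₙ|² < ∞`. -/
def holSubmodule (k : Param) : Submodule ℂ (𝔻 → ℂ) where
  carrier := {f | ∃ a : ℕ → ℂ, HasTaylor f a ∧ Summable fun n => weight k n * ‖a n‖ ^ 2}
  zero_mem' := ⟨0, fun z => by simp, by simp⟩
  add_mem' := by
    rintro f g ⟨a, ha, hsa⟩ ⟨b, hb, hsb⟩
    refine ⟨a + b, fun z => by simpa [add_mul] using (ha z).add (hb z), ?_⟩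
    refine Summable.of_nonneg_of_le (fun n => mul_nonneg (weight_pos k n).le (sq_nonneg _))
      (fun n => ?_) ((hsa.mul_left 2).add (hsb.mul_left 2))
    have h1 := weight_pos k n
    have h2 : ‖a n + b n‖ ^ 2 ≤ 2 * ‖a n‖ ^ 2 + 2 * ‖b n‖ ^ 2 := by
      have := norm_add_le (a n) (b n)
      nlinarith [norm_nonneg (a n + b n), sq_nonneg (‖a n‖ - ‖b n‖)]
    have := mul_le_mul_of_nonneg_left h2 h1.le
    simp only [Pi.add_apply]
    linarith
  smul_mem' := by
    rintro c f ⟨a, ha, hsa⟩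
    refine ⟨c • a, fun z => by simpa [mul_assoc] using (ha z).mul_left c, ?_⟩
    refine (hsa.mul_left (‖c‖ ^ 2)).congr fun n => ?_
    simp only [Pi.smul_apply, smul_eq_mul, norm_mul]
    ring

/-- The vector space underlying the Hilbert space. It is a type of its own, so that it carries
the topology of its norm and not the topology of pointwise convergence. -/
def HolSpace (k : Param) : Type := holSubmodule k

namespace HolSpace

variable {k : Param}

instance : AddCommGroup (HolSpace k) := inferInstanceAs (AddCommGroup (holSubmodule k))

instance : Module ℂ (HolSpace k) := inferInstanceAs (Module ℂ (holSubmodule k))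

instance : CoeFun (HolSpace k) (fun _ => 𝔻 → ℂ) := ⟨fun f => f.1⟩

/-- The Taylor coefficients of `f` at `0`. -/
def coeff (f : HolSpace k) : ℕ → ℂ := f.2.choose

theorem hasTaylor (f : HolSpace k) : HasTaylor f f.coeff := f.2.choose_spec.1

theorem summable_coeff (f : HolSpace k) : Summable fun n => weight k n * ‖f.coeff n‖ ^ 2 :=
  f.2.choose_spec.2

theorem ext_coeff {f g : HolSpace k} (h : f.coeff = g.coeff) : f = g := by
  apply Subtype.ext
  funext z
  exact (hasTaylor f z).unique (h ▸ hasTaylor g z)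

theorem coeff_add (f g : HolSpace k) : (f + g).coeff = f.coeff + g.coeff :=
  (hasTaylor (f + g)).unique fun z => by
    have h := (hasTaylor f z).add (hasTaylor g z)
    simp only [← add_mul] at h
    exact h

theorem coeff_smul (c : ℂ) (f : HolSpace k) : (c • f).coeff = c • f.coeff :=
  (hasTaylor (c • f)).unique fun z => by
    have h := (hasTaylor f z).mul_left c
    simp only [← mul_assoc] at h
    exact h

theorem coeff_zero : (0 : HolSpace k).coeff = 0 :=
  (hasTaylor (0 : HolSpace k)).unique fun z => by
    have h : HasSum (fun _ : ℕ => (0 : ℂ)) 0 := hasSum_zero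
    simp only [Pi.zero_apply, zero_mul]
    exact h

/-- The scalar product `∑ Γ(2k) Γ(n+1) / Γ(2k+n) conj aₙ bₙ`. -/
def scalarProduct (f g : HolSpace k) : ℂ :=
  ∑' n, (weight k n : ℂ) * (conj (f.coeff n) * g.coeff n)

theorem summable_inner (f g : HolSpace k) :
    Summable fun n => (weight k n : ℂ) * (conj (f.coeff n) * g.coeff n) := by
  refine Summable.of_norm_bounded ((summable_coeff f).add (summable_coeff g)) fun n => ?_
  have h1 := weight_pos k n
  rw [norm_mul, norm_mul, Complex.norm_conj, Complex.norm_real, Real.norm_eq_abs, abs_of_pos h1,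
    ← mul_add]
  refine mul_le_mul_of_nonneg_left ?_ h1.le
  nlinarith [sq_nonneg (‖f.coeff n‖ - ‖g.coeff n‖), sq_nonneg ‖f.coeff n‖, sq_nonneg ‖g.coeff n‖]

theorem scalarProduct_self (f : HolSpace k) :
    scalarProduct f f = ((∑' n, weight k n * ‖f.coeff n‖ ^ 2 : ℝ) : ℂ) := by
  rw [scalarProduct, Complex.ofReal_tsum]
  congr 1
  funext n
  rw [mul_comm (conj _), SU11Cover.mul_conj_eq]
  push_cast
  rfl

/-- The scalar product is positive definite. -/
@[reducible]
def core (k : Param) : InnerProductSpace.Core ℂ (HolSpace k) where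
  inner := scalarProduct
  conj_inner_symm f g := by
    change conj (scalarProduct g f) = scalarProduct f g
    rw [scalarProduct, scalarProduct, Complex.conj_tsum]
    congr 1
    funext n
    simp only [map_mul, Complex.conj_ofReal, Complex.conj_conj]
    ring
  re_inner_nonneg f := by
    change 0 ≤ (scalarProduct f f).re
    rw [scalarProduct_self]
    exact tsum_nonneg fun n => mul_nonneg (weight_pos k n).le (sq_nonneg _)
  add_left f g h := by
    change scalarProduct (f + g) h = scalarProduct f h + scalarProduct g h
    rw [scalarProduct, scalarProduct, scalarProduct, ← (summable_inner f h).tsum_add (summable_inner g h)]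
    congr 1
    funext n
    rw [coeff_add, Pi.add_apply, map_add]
    ring
  smul_left f g c := by
    change scalarProduct (c • f) g = conj c * scalarProduct f g
    rw [scalarProduct, scalarProduct, ← tsum_mul_left]
    congr 1
    funext n
    rw [coeff_smul, Pi.smul_apply, smul_eq_mul, map_mul]
    ring
  definite f hf := by
    change scalarProduct f f = 0 at hf
    rw [scalarProduct_self, Complex.ofReal_eq_zero] at hf
    have h0 := fun n => mul_nonneg (weight_pos k n).le (sq_nonneg ‖f.coeff n‖)
    have h1 := (hasSum_zero_iff_of_nonneg h0).1 (hf ▸ (summable_coeff f).hasSum)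
    apply ext_coeff
    rw [coeff_zero]
    funext n
    have h2 := congrFun h1 n
    simpa [(weight_pos k n).ne'] using h2

instance : NormedAddCommGroup (HolSpace k) := (core k).toNormedAddCommGroup

instance : InnerProductSpace ℂ (HolSpace k) := InnerProductSpace.ofCore (core k).toCore

theorem inner_def (f g : HolSpace k) : inner ℂ f g = scalarProduct f g := rfl

theorem norm_sq_eq (f : HolSpace k) : ‖f‖ ^ 2 = ∑' n, weight k n * ‖f.coeff n‖ ^ 2 := by
  have h := inner_self_eq_norm_sq_to_K (𝕜 := ℂ) f
  rw [inner_def, scalarProduct_self] at h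
  have h2 : ((∑' n, weight k n * ‖f.coeff n‖ ^ 2 : ℝ) : ℂ) = ((‖f‖ ^ 2 : ℝ) : ℂ) := by
    rw [h]; push_cast; rfl
  exact (Complex.ofReal_injective h2).symm

theorem memlp (f : HolSpace k) :
    Memℓp (fun n => ((Real.sqrt (weight k n) : ℝ) : ℂ) * f.coeff n) 2 := by
  apply memℓp_gen
  refine (summable_coeff f).congr fun n => ?_
  rw [norm_mul, Complex.norm_real, Real.norm_eq_abs, abs_of_nonneg (Real.sqrt_nonneg _)]
  norm_num
  rw [mul_pow, Real.sq_sqrt (weight_pos k n).le]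

/-- The isometry `f ↦ (√wₙ aₙ)ₙ` onto `ℓ²`. -/
def toLp (k : Param) : HolSpace k ≃ₗᵢ[ℂ] lp (fun _ : ℕ => ℂ) 2 :=
  LinearIsometryEquiv.ofSurjective
    { toFun := fun f => ⟨_, memlp f⟩
      map_add' := fun f g => by
        apply Subtype.ext
        funext n
        change ((Real.sqrt (weight k n) : ℝ) : ℂ) * (f + g).coeff n =
          ((Real.sqrt (weight k n) : ℝ) : ℂ) * f.coeff n +
            ((Real.sqrt (weight k n) : ℝ) : ℂ) * g.coeff n
        simp only [coeff_add, Pi.add_apply]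
        ring
      map_smul' := fun c f => by
        apply Subtype.ext
        funext n
        change ((Real.sqrt (weight k n) : ℝ) : ℂ) * (c • f).coeff n =
          c * (((Real.sqrt (weight k n) : ℝ) : ℂ) * f.coeff n)
        simp only [coeff_smul, Pi.smul_apply, smul_eq_mul]
        ring
      norm_map' := fun f => by
        have h : ∀ x y : ℝ, 0 ≤ x → 0 ≤ y → x ^ 2 = y ^ 2 → x = y := fun x y hx hy hxy =>
          (pow_left_inj₀ hx hy two_ne_zero).1 hxy
        apply h _ _ (norm_nonneg _) (norm_nonneg _)
        rw [norm_sq_eq]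
        have h2 := lp.norm_rpow_eq_tsum (p := 2) (by norm_num)
          (⟨_, memlp f⟩ : lp (fun _ : ℕ => ℂ) 2)
        norm_num at h2
        refine h2.trans ?_
        congr 1
        funext n
        rw [mul_pow, abs_of_nonneg (Real.sqrt_nonneg _), Real.sq_sqrt (weight_pos k n).le] }
    (by
      intro x
      let a : ℕ → ℂ := fun n => x n / ((Real.sqrt (weight k n) : ℝ) : ℂ)
      have hs : ∀ n, 1 ≤ Real.sqrt (weight k n) := fun n => by
        rw [Real.one_le_sqrt]; exact weight_ge_one k n
      have hn : ∀ n, ‖a n‖ = ‖x n‖ / Real.sqrt (weight k n) := fun n => by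
        simp only [a]
        rw [norm_div, Complex.norm_real, Real.norm_eq_abs, abs_of_nonneg (Real.sqrt_nonneg _)]
      have hx : ∀ n, ‖a n‖ ≤ ‖x‖ := fun n => by
        rw [hn]
        exact (div_le_self (norm_nonneg _) (hs n)).trans
          (lp.norm_apply_le_norm (by norm_num) x n)
      have hsum : ∀ z : 𝔻, Summable fun n : ℕ => a n * (z : ℂ) ^ n := fun z => by
        refine Summable.of_norm_bounded
          ((summable_geometric_of_lt_one (norm_nonneg _) z.norm_lt_one).mul_left ‖x‖) fun n => ?_
        rw [norm_mul, norm_pow]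
        exact mul_le_mul_of_nonneg_right (hx n) (by positivity)
      have hT : HasTaylor (fun z => ∑' n : ℕ, a n * (z : ℂ) ^ n) a := fun z => (hsum z).hasSum
      have hw : Summable fun n => weight k n * ‖a n‖ ^ 2 := by
        have h2 := (lp.memℓp x).summable (by norm_num)
        refine h2.congr fun n => ?_
        rw [hn, div_pow, Real.sq_sqrt (weight_pos k n).le]
        have := (weight_pos k n).ne'
        norm_num
        field_simp
      let f : HolSpace k := ⟨_, a, hT, hw⟩
      have hf : f.coeff = a := (hasTaylor f).unique hT
      refine ⟨f, ?_⟩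
      apply Subtype.ext
      funext n
      change ((Real.sqrt (weight k n) : ℝ) : ℂ) * f.coeff n = x n
      have h3 : ((Real.sqrt (weight k n) : ℝ) : ℂ) ≠ 0 := by
        have := hs n
        exact_mod_cast (by linarith : (0 : ℝ) < Real.sqrt (weight k n)).ne'
      rw [hf]
      simp only [a]
      field_simp)

instance : CompleteSpace (HolSpace k) :=
  (toLp k).toIsometryEquiv.completeSpace_iff.2 inferInstance

end HolSpace

/-! ### Representations -/

/-- `e^{2ikω} (1 - |γ|²)^k (1 + conj γ z)^{-2k} f ((a z + b) / (conj b z + conj a))`, with the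
principal branch of the power of `1 + conj γ z`, a number in the right half-plane. -/
def repFormula (k : ℝ) (g : SU11Cover) (f : 𝔻 → ℂ) (z : 𝔻) : ℂ :=
  exp (2 * I * k * g.ω) * ((1 - ‖(g.γ : ℂ)‖ ^ 2) ^ k : ℝ) *
    (1 + conj (g.γ : ℂ) * z) ^ (-2 * k : ℂ) * f (g.moebius z)

/-- A unitary representation (a homomorphism into the group of unitary operators of a Hilbert
space) is continuous and irreducible if it is strongly continuous, the space is not zero, and
the only closed invariant subspaces are zero and the whole space. -/
structure IsContinuousIrreducible {G H : Type*} [Group G] [TopologicalSpace G]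
    [NormedAddCommGroup H] [InnerProductSpace ℂ H] [CompleteSpace H]
    (π : G →* (H ≃ₗᵢ[ℂ] H)) : Prop where
  continuous : ∀ v : H, Continuous fun g => π g v
  nontrivial : Nontrivial H
  irreducible : ∀ V : Submodule ℂ H, IsClosed (V : Set H) →
    (∀ g, ∀ v ∈ V, π g v ∈ V) → V = ⊥ ∨ V = ⊤

end

/-! The covering statement comes from polar coordinates: `b / a` and `a / |a|` identify `SU(1,1)`
with disc × circle, and `proj` becomes the identity times `ω ↦ e^{iω}`. This map is open with kernel
`γ = 0`, `ω ∈ 2πℤ`.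

The operators are governed by the automorphy factor `conj b z + conj a`. On the cover `ω` fixes an
argument of `a`, hence a logarithm `logFactor` of that factor, and the formula becomes `exp (-2k
logFactor) * f (g z)`. Two identities carry the proof: the cocycle relation `logFactor_mul`, which
gives the multiplication law, and the covariance `log_one_sub_moebius` of `1 - conj w z`. Each holds
after exponentiation by algebra; no multiple of `2πi` is lost because only four arguments below
`π/2` remain.

Unitarity uses no estimate of Taylor coefficients. The inverse weights are the coefficients of `(1 -
x)^{-2k}`, so `(1 - conj w z)^{-2k}` is a reproducing kernel. Covariance says that moving the
kernels preserves their Gram matrix (`inner_movedKernel`); this extends to a contraction whose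
adjoint is the desired operator. The operator of `g⁻¹` is also a contraction, so both are unitary.

Strong continuity need only be checked on kernels, whose orbits are explicit. For irreducibility,
the projection of the constant `1` to an invariant subspace is invariant under rotations, hence
constant; so `1` lies in the subspace or in its orthogonal complement. As the disc is one orbit, `1`
generates all kernels. -/

noncomputable section

/-! ### The covering group and its topology -/

namespace SU11Cover

/-- The coordinates `(γ, ω)` as a homeomorphism. -/
def homeomorphProd : SU11Cover ≃ₜ 𝔻 × ℝ where
  toFun g := (g.γ, g.ω)
  invFun p := ⟨p.1, p.2⟩
  left_inv _ := rfl
  right_inv _ := rfl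
  continuous_toFun := continuous_induced_dom
  continuous_invFun := continuous_induced_rng.2 continuous_id

@[fun_prop]
theorem continuous_γ : Continuous fun g : SU11Cover => g.γ :=
  continuous_fst.comp homeomorphProd.continuous

@[fun_prop]
theorem continuous_coe_γ : Continuous fun g : SU11Cover => (g.γ : ℂ) :=
  Complex.UnitDisc.continuous_coe.comp continuous_γ

@[fun_prop]
theorem continuous_ω : Continuous fun g : SU11Cover => g.ω :=
  continuous_snd.comp homeomorphProd.continuous

theorem continuous_of_coordinates {X : Type*} [TopologicalSpace X] {f : X → SU11Cover}
    (hγ : Continuous fun x => ((f x).γ : ℂ)) (hω : Continuous fun x => (f x).ω) :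
    Continuous f :=
  continuous_induced_rng.2
    ((Complex.UnitDisc.isEmbedding_coe.continuous_iff.2 hγ).prodMk hω)

theorem cocycle_mem_slitPlane (g h : SU11Cover) : cocycle g h ∈ slitPlane :=
  mem_slitPlane_iff_arg.2
    ⟨fun e => by
      have := abs_arg_cocycle g h
      rw [e, abs_of_pos Real.pi_pos] at this
      linarith [Real.pi_pos], cocycle_ne_zero g h⟩

theorem continuous_cocycle : Continuous fun p : SU11Cover × SU11Cover => cocycle p.1 p.2 := by
  unfold cocycle
  fun_prop

instance : IsTopologicalGroup SU11Cover where
  continuous_mul := by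
    apply continuous_of_coordinates
    · simp only [mul_γ]
      exact Continuous.div (by fun_prop) continuous_cocycle fun p => cocycle_ne_zero _ _
    · simp only [mul_ω]
      have h : Continuous fun p : SU11Cover × SU11Cover => arg (cocycle p.1 p.2) :=
        continuous_iff_continuousAt.2 fun p =>
          (continuousAt_arg (cocycle_mem_slitPlane p.1 p.2)).comp
            (f := fun p : SU11Cover × SU11Cover => cocycle p.1 p.2)
            continuous_cocycle.continuousAt
      fun_prop
  continuous_inv := by
    apply continuous_of_coordinates
    · simp only [inv_γ]
      fun_prop
    · simp only [inv_ω]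
      fun_prop

theorem _root_.Complex.UnitDisc.contractibleSpace : ContractibleSpace 𝔻 :=
  Metric.contractibleSpace_ball (x := (0 : ℂ)) one_pos

instance : SimplyConnectedSpace SU11Cover :=
  haveI := Complex.UnitDisc.contractibleSpace
  haveI : ContractibleSpace SU11Cover := homeomorphProd.contractibleSpace
  inferInstance

/-! ### The projection onto `SU(1,1)` as a covering map. -/

@[fun_prop]
theorem continuous_a : Continuous a := by
  have h : Continuous fun g : SU11Cover => (1 - ‖(g.γ : ℂ)‖ ^ 2) ^ (-(1 / 2) : ℝ) :=
    Continuous.rpow_const (by fun_prop) fun g => Or.inl (one_sub_pos g.γ).ne'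
  unfold a
  fun_prop

@[fun_prop]
theorem continuous_b : Continuous b := by
  rw [funext b_eq]
  fun_prop

theorem proj_apply_zero_zero (g : SU11Cover) : (proj g).1.1 0 0 = g.a := rfl

theorem proj_apply_zero_one (g : SU11Cover) : (proj g).1.1 0 1 = g.b := rfl

theorem continuous_proj : Continuous proj := by
  apply Continuous.subtype_mk
  apply Continuous.subtype_mk
  refine continuous_matrix fun i j => ?_
  fin_cases i <;> fin_cases j <;> simp <;> fun_prop

theorem _root_.SU11.ext_row {x y : SU11} (h0 : x.1.1 0 0 = y.1.1 0 0)
    (h1 : x.1.1 0 1 = y.1.1 0 1) : x = y := by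
  obtain ⟨hx, hx'⟩ := x.2
  obtain ⟨hy, hy'⟩ := y.2
  apply Subtype.ext
  apply Subtype.ext
  ext i j
  fin_cases i <;> fin_cases j
  · exact h0
  · exact h1
  · exact hx.trans (by rw [h1]; exact hy.symm)
  · exact hx'.trans (by rw [h0]; exact hy'.symm)

theorem _root_.SU11.norm_sq_sub (x : SU11) : ‖x.1.1 0 0‖ ^ 2 - ‖x.1.1 0 1‖ ^ 2 = 1 := by
  obtain ⟨h1, h2⟩ := x.2
  have h := x.1.2
  rw [Matrix.det_fin_two, h1, h2, mul_conj_eq, mul_conj_eq] at h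
  exact_mod_cast h

theorem proj_surjective : Function.Surjective proj := by
  intro x
  have hx := SU11.norm_sq_sub x
  set p := x.1.1 0 0 with hp
  set q := x.1.1 0 1 with hq
  have hp0 : 0 < ‖p‖ := by
    by_contra h
    have : ‖p‖ = 0 := le_antisymm (not_lt.1 h) (norm_nonneg _)
    nlinarith [sq_nonneg ‖q‖]
  have hlt : ‖q / p‖ < 1 := by
    rw [norm_div, div_lt_one hp0]
    exact lt_of_pow_lt_pow_left₀ 2 hp0.le (by linarith)
  -- Forced by `b = a γ` and, up to multiples of `2π`, by the polar form of `a`.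
  let g : SU11Cover := ⟨.mk (q / p) hlt, arg p⟩
  have e : 1 - ‖(g.γ : ℂ)‖ ^ 2 = ‖p‖ ^ (-2 : ℝ) := by
    change 1 - ‖q / p‖ ^ 2 = _
    rw [Real.rpow_neg hp0.le, norm_div]
    norm_num
    field_simp
    linarith
  have ha : g.a = p := by
    rw [a, e, ← Real.rpow_mul hp0.le]
    norm_num
    rw [mul_comm, mul_comm I]
    exact norm_mul_exp_arg_mul_I p
  refine ⟨g, SU11.ext_row ha ?_⟩
  rw [proj_apply_zero_one, b_eq, ha]
  exact mul_div_cancel₀ q (norm_pos_iff.1 hp0)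

theorem exp_ω (g : SU11Cover) : exp (I * g.ω) = g.a / ‖g.a‖ := by
  have h0 := norm_ne_zero_iff.2 (a_ne_zero g)
  have h := Real.rpow_pos_of_pos (one_sub_pos g.γ) (-(1 / 2))
  have e : ‖g.a‖ = (1 - ‖(g.γ : ℂ)‖ ^ 2) ^ (-(1 / 2) : ℝ) := by
    rw [a, norm_mul, norm_exp_I, one_mul, Complex.norm_real, Real.norm_of_nonneg h.le]
  rw [eq_div_iff (by exact_mod_cast h0), e]
  rfl

/-- In polar coordinates `proj` is `id × Circle.exp`, an open map, and openness is carried back to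
`SU11`. -/
theorem isQuotientMap_proj : Topology.IsQuotientMap proj := by
  have hx0 (x : SU11) : x.1.1 0 0 ≠ 0 := by
    obtain ⟨g, rfl⟩ := proj_surjective x
    exact a_ne_zero g
  -- The polar coordinates take values in `ℂ × ℂ`, so that continuity is plain division; the
  -- embedding `ψ` below returns to disc × circle.
  let φ : SU11 → ℂ × ℂ := fun x => (x.1.1 0 1 / x.1.1 0 0, x.1.1 0 0 / ‖x.1.1 0 0‖)
  have hent (i j : Fin 2) : Continuous fun x : SU11 => x.1.1 i j := by
    have h : Continuous fun x : SU11 => x.1.1 :=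
      continuous_subtype_val.comp (continuous_subtype_val (p := fun x => x ∈ SU11))
    exact h.matrix_elem i j
  have hφ : Continuous φ :=
    ((hent 0 1).div (hent 0 0) hx0).prodMk
      ((hent 0 0).div (by have := hent 0 0; fun_prop) fun x => by
        exact_mod_cast norm_ne_zero_iff.2 (hx0 x))
  let ψ : 𝔻 × Circle → ℂ × ℂ := Prod.map (↑) (↑)
  have hψ : Topology.IsEmbedding ψ :=
    Complex.UnitDisc.isEmbedding_coe.prodMap Topology.IsEmbedding.subtypeVal
  let χ : SU11Cover → 𝔻 × Circle := Prod.map id Circle.exp ∘ homeomorphProd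
  have hcomp (g : SU11Cover) : φ (proj g) = ψ (χ g) := by
    refine Prod.ext ?_ ?_
    · change g.b / g.a = g.γ
      rw [b_eq, mul_div_cancel_left₀ _ (a_ne_zero g)]
    · change g.a / ‖g.a‖ = Circle.exp g.ω
      rw [← exp_ω, Circle.coe_exp, mul_comm]
  have hχ : IsOpenMap χ :=
    (IsOpenMap.id.prodMap isLocalHomeomorph_circleExp.isOpenMap).comp homeomorphProd.isOpenMap
  have hinj : ∀ g h : SU11Cover, χ g = χ h → proj g = proj h := by
    intro g h e
    have eγ : g.γ = h.γ := congrArg Prod.fst e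
    have eω : Circle.exp g.ω = Circle.exp h.ω := congrArg Prod.snd e
    have ea : g.a = h.a := by
      have := congrArg (fun z : Circle => (z : ℂ)) eω
      simp only [Circle.coe_exp] at this
      rw [a, a, eγ, mul_comm I, mul_comm I, this]
    refine SU11.ext_row ea ?_
    rw [proj_apply_zero_one, proj_apply_zero_one, b_eq, b_eq, ea, eγ]
  refine IsOpenMap.isQuotientMap (fun W hW => ?_) continuous_proj proj_surjective
  -- The image of `W` is the preimage under `φ` of any open `O` whose trace on disc × circle is `χ
  -- '' W`.
  obtain ⟨O, hO, hOW⟩ := hψ.isInducing.isOpen_iff.1 (hχ W hW)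
  convert hO.preimage hφ using 1
  ext x
  obtain ⟨g, rfl⟩ := proj_surjective x
  have hiff : φ (proj g) ∈ O ↔ χ g ∈ χ '' W := by rw [hcomp, ← hOW, Set.mem_preimage]
  refine Iff.trans ?_ hiff.symm
  constructor
  · rintro ⟨h, hh, e⟩
    refine ⟨h, hh, hψ.injective ?_⟩
    rw [← hcomp, ← hcomp, e]
  · rintro ⟨h, hh, e⟩
    exact ⟨h, hh, hinj _ _ e⟩

theorem isDiscrete_ker_proj : IsDiscrete (proj.ker : Set SU11Cover) := by
  refine isDiscrete_iff_discreteTopology.2 (discreteTopology_of_isOpen_singleton_one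
    (G := proj.ker) ?_)
  -- On the kernel `ω` is a multiple of `2π`, so this bound isolates the identity.
  have hU : IsOpen {g : proj.ker | |g.1.ω| < 2 * Real.pi} :=
    isOpen_lt (by fun_prop) continuous_const
  convert hU using 1
  ext ⟨g, hg⟩
  simp only [Set.mem_singleton_iff, Set.mem_ofPred_eq, Subgroup.mk_eq_one]
  constructor
  · rintro rfl
    rw [one_ω, abs_zero]
    positivity
  · intro hω
    have hp : proj g = 1 := hg
    have ha : g.a = 1 := by rw [← proj_apply_zero_zero, hp]; rfl
    have hb : g.b = 0 := by rw [← proj_apply_zero_one, hp]; rfl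
    have he := exp_ω g
    rw [ha, norm_one, Complex.ofReal_one, div_one, mul_comm] at he
    refine ext_a (by rw [ha, a_one]) (by rw [hb, b_one]) ?_
    obtain ⟨n, hn⟩ := Circle.exp_eq_one.1 (Circle.ext (by rw [Circle.coe_exp, he]; rfl))
    rw [hn, abs_mul, abs_of_pos Real.two_pi_pos] at hω
    have h1 : |(n : ℝ)| < 1 := by
      by_contra h
      nlinarith [Real.two_pi_pos, not_lt.1 h]
    have h2 : n = 0 := Int.abs_lt_one_iff.1 (by exact_mod_cast h1)
    rw [hn, h2, one_ω]
    simp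

theorem isCoveringMap_proj : IsCoveringMap proj :=
  (Topology.IsQuotientMap.isQuotientCoveringMap_of_isDiscrete_ker_monoidHom
    isQuotientMap_proj isDiscrete_ker_proj).isCoveringMap

end SU11Cover

end

noncomputable section

/-! ### The factor of automorphy and its logarithm -/

/-- Every branch question below is settled here: algebra gives equal exponentials, and bounds on
arguments exclude a nonzero multiple of `2πi`. -/
theorem Complex.eq_of_exp_eq_of_abs_im_sub_lt {x y : ℂ} (h : exp x = exp y)
    (him : |x.im - y.im| < 2 * Real.pi) : x = y := by
  obtain ⟨n, hn⟩ := Complex.exp_eq_exp_iff_exists_int.1 h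
  have h1 : x.im - y.im = n * (2 * Real.pi) := by
    rw [hn]
    simp
  rw [h1, abs_mul, abs_of_pos Real.two_pi_pos] at him
  have h2 : |(n : ℝ)| < 1 := by
    by_contra h
    nlinarith [Real.two_pi_pos, not_lt.1 h]
  have h3 : n = 0 := Int.abs_lt_one_iff.1 (by exact_mod_cast h2)
  simpa [h3] using hn

namespace SU11Cover

theorem norm_conj_mul_lt (w z : 𝔻) : ‖conj (w : ℂ) * z‖ < 1 := by
  rw [mul_comm]
  exact norm_mul_conj_lt z.norm_lt_one w.norm_lt_one

theorem norm_neg_conj_mul_lt (w z : 𝔻) : ‖-(conj (w : ℂ) * z)‖ < 1 := by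
  rw [norm_neg]
  exact norm_conj_mul_lt w z

theorem one_sub_conj_mul_ne_zero (w z : 𝔻) : 1 - conj (w : ℂ) * z ≠ 0 := by
  rw [sub_eq_add_neg]
  exact one_add_ne_zero (norm_neg_conj_mul_lt w z)

theorem abs_arg_one_sub (w z : 𝔻) : |arg (1 - conj (w : ℂ) * z)| < Real.pi / 2 := by
  rw [sub_eq_add_neg]
  exact arg_one_add (norm_neg_conj_mul_lt w z)

theorem mem_slitPlane_of_abs_arg_lt {z : ℂ} (hz : z ≠ 0) (h : |arg z| < Real.pi / 2) :
    z ∈ slitPlane :=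
  mem_slitPlane_iff_arg.2
    ⟨fun e => by
      rw [e, abs_of_pos Real.pi_pos] at h
      linarith [Real.pi_pos], hz⟩

/-- The logarithm of `conj b z + conj a` with imaginary part `arg (1 + conj γ z) - ω`. -/
def logFactor (g : SU11Cover) (z : 𝔻) : ℂ :=
  log (1 + conj (g.γ : ℂ) * z) - ((Real.log (1 - ‖(g.γ : ℂ)‖ ^ 2) / 2 : ℝ) : ℂ) - I * g.ω

theorem logFactor_im (g : SU11Cover) (z : 𝔻) :
    (logFactor g z).im = arg (1 + conj (g.γ : ℂ) * z) - g.ω := by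
  simp [logFactor, log_im, -Complex.ofReal_div]

theorem exp_logFactor (g : SU11Cover) (z : 𝔻) :
    exp (logFactor g z) = conj g.b * z + conj g.a := by
  have h1 : exp (-((Real.log (1 - ‖(g.γ : ℂ)‖ ^ 2) / 2 : ℝ) : ℂ)) =
      (((1 - ‖(g.γ : ℂ)‖ ^ 2) ^ (-(1 / 2) : ℝ) : ℝ) : ℂ) := by
    rw [Real.rpow_def_of_pos (one_sub_pos g.γ), Complex.ofReal_exp, ← Complex.ofReal_neg]
    congr 2
    ring
  have h2 : conj g.a = exp (-(I * g.ω)) *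
      (((1 - ‖(g.γ : ℂ)‖ ^ 2) ^ (-(1 / 2) : ℝ) : ℝ) : ℂ) := by
    rw [a, map_mul, Complex.conj_ofReal, conj_exp_I]
  rw [logFactor, sub_eq_add_neg, sub_eq_add_neg, Complex.exp_add, Complex.exp_add,
    exp_log (one_add_ne_zero (norm_conj_mul_lt g.γ z)), h1, b_eq, map_mul, h2]
  ring

theorem denom_ne_zero (g : SU11Cover) (z : 𝔻) : conj g.b * z + conj g.a ≠ 0 := by
  rw [← exp_logFactor]
  exact exp_ne_zero _

theorem coe_moebius (g : SU11Cover) (z : 𝔻) :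
    (g.moebius z : ℂ) = (g.a * z + g.b) / (conj g.b * z + conj g.a) := rfl

theorem moebius_mul (g h : SU11Cover) (z : 𝔻) :
    (g * h).moebius z = g.moebius (h.moebius z) := by
  apply Complex.UnitDisc.coe_injective
  have h1 := denom_ne_zero h z
  have h2 := denom_ne_zero g (h.moebius z)
  have h3 := denom_ne_zero (g * h) z
  rw [coe_moebius, coe_moebius, div_eq_div_iff h3 h2]
  rw [coe_moebius, a_mul, b_mul]
  simp only [map_add, map_mul, Complex.conj_conj]
  field_simp
  ring

theorem moebius_one (z : 𝔻) : (1 : SU11Cover).moebius z = z := by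
  apply Complex.UnitDisc.coe_injective
  simp [coe_moebius, a_one, b_one]

/-- The chain rule for the automorphy factor, lifted to logarithms. In the imaginary parts the `ω`'s
cancel by the group law, leaving `arg (cocycle g h)` and three further arguments, each below `π/2`
in absolute value. -/
theorem logFactor_mul (g h : SU11Cover) (z : 𝔻) :
    logFactor (g * h) z = logFactor g (h.moebius z) + logFactor h z := by
  apply Complex.eq_of_exp_eq_of_abs_im_sub_lt
  · have h1 := denom_ne_zero h z
    rw [Complex.exp_add, exp_logFactor, exp_logFactor, exp_logFactor, coe_moebius, a_mul, b_mul]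
    simp only [map_add, map_mul, Complex.conj_conj]
    field_simp
    ring
  · rw [Complex.add_im, logFactor_im, logFactor_im, logFactor_im, mul_ω]
    have h1 := abs_lt.1 (abs_arg_cocycle g h)
    have h2 := abs_lt.1 (arg_one_add (norm_conj_mul_lt (g * h).γ z))
    have h3 := abs_lt.1 (arg_one_add (norm_conj_mul_lt g.γ (h.moebius z)))
    have h4 := abs_lt.1 (arg_one_add (norm_conj_mul_lt h.γ z))
    rw [abs_lt]
    constructor <;> linarith [h1.1, h1.2, h2.1, h2.2, h3.1, h3.2, h4.1, h4.2]

theorem logFactor_one (z : 𝔻) : logFactor 1 z = 0 := by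
  simp [logFactor, one_γ, one_ω]

/-- Covariance of the kernel, in logarithmic form. The conjugation makes the two contributions of
`ω` cancel, so again four arguments below `π/2` remain. -/
theorem log_one_sub_moebius (g : SU11Cover) (w z : 𝔻) :
    log (1 - conj (g.moebius w : ℂ) * g.moebius z) + logFactor g z + conj (logFactor g w) =
      log (1 - conj (w : ℂ) * z) := by
  apply Complex.eq_of_exp_eq_of_abs_im_sub_lt
  · have h1 := denom_ne_zero g z
    have h2 := (map_ne_zero (starRingEnd ℂ)).2 (denom_ne_zero g w)
    rw [Complex.exp_add, Complex.exp_add, exp_log (one_sub_conj_mul_ne_zero _ _),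
      exp_log (one_sub_conj_mul_ne_zero _ _), Complex.exp_conj, exp_logFactor, exp_logFactor,
      coe_moebius, coe_moebius, map_div₀]
    simp only [map_add, map_mul, Complex.conj_conj] at h2 ⊢
    -- With `a'`, `b'` and `w` in place of the conjugates of `a`, `b` and of the point `w`, the
    -- identity is purely algebraic and follows from the determinant.
    have key (a a' b b' z w : ℂ) (h1 : b' * z + a' ≠ 0) (h2 : b * w + a ≠ 0)
        (hd : a * a' - b * b' = 1) :
        (1 - (a' * w + b') / (b * w + a) * ((a * z + b) / (b' * z + a'))) * (b' * z + a') *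
          (b * w + a) = 1 - w * z := by
      rw [div_mul_div_comm, one_sub_div (mul_ne_zero h2 h1), div_mul_eq_mul_div, div_mul_eq_mul_div,
        div_eq_iff (mul_ne_zero h2 h1)]
      linear_combination ((1 - w * z) * (b * w + a) * (b' * z + a')) * hd
    exact key _ _ _ _ _ _ h1 h2 (a_b_det g)
  · rw [Complex.add_im, Complex.add_im, Complex.conj_im, log_im, log_im, logFactor_im,
      logFactor_im]
    have h1 := abs_lt.1 (abs_arg_one_sub (g.moebius w) (g.moebius z))
    have h2 := abs_lt.1 (abs_arg_one_sub w z)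
    have h3 := abs_lt.1 (arg_one_add (norm_conj_mul_lt g.γ z))
    have h4 := abs_lt.1 (arg_one_add (norm_conj_mul_lt g.γ w))
    rw [abs_lt]
    constructor <;> linarith [h1.1, h1.2, h2.1, h2.2, h3.1, h3.2, h4.1, h4.2]

/-- The factor `(conj b z + conj a)^{-2k}` of the representation. -/
def multiplier (k : ℝ) (g : SU11Cover) (z : 𝔻) : ℂ :=
  exp (-2 * k * logFactor g z)

theorem multiplier_ne_zero (k : ℝ) (g : SU11Cover) (z : 𝔻) : multiplier k g z ≠ 0 :=
  exp_ne_zero _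

theorem multiplier_mul (k : ℝ) (g h : SU11Cover) (z : 𝔻) :
    multiplier k (g * h) z = multiplier k h z * multiplier k g (h.moebius z) := by
  rw [multiplier, multiplier, multiplier, logFactor_mul, ← Complex.exp_add]
  ring_nf

theorem multiplier_one (k : ℝ) (z : 𝔻) : multiplier k 1 z = 1 := by
  rw [multiplier, logFactor_one, mul_zero, Complex.exp_zero]

/-- The three scalar factors are the exponentials of `-2k` times the three terms of `logFactor`. -/
theorem _root_.repFormula_eq (k : ℝ) (g : SU11Cover) (f : 𝔻 → ℂ) (z : 𝔻) :
    repFormula k g f z = multiplier k g z * f (g.moebius z) := by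
  rw [repFormula, multiplier, cpow_def_of_ne_zero (one_add_ne_zero (norm_conj_mul_lt g.γ z)),
    Real.rpow_def_of_pos (one_sub_pos g.γ), Complex.ofReal_exp, ← Complex.exp_add,
    ← Complex.exp_add, logFactor]
  congr 2
  push_cast
  ring

theorem continuous_logFactor (z : 𝔻) : Continuous fun g => logFactor g z := by
  have h1 : Continuous fun g : SU11Cover => log (1 + conj (g.γ : ℂ) * z) := by
    refine Continuous.clog ?_ fun g => ?_
    · have : Continuous fun g : SU11Cover => conj (g.γ : ℂ) :=
        Complex.continuous_conj.comp continuous_coe_γ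
      fun_prop
    · exact mem_slitPlane_of_abs_arg_lt (one_add_ne_zero (norm_conj_mul_lt g.γ z))
        (arg_one_add (norm_conj_mul_lt g.γ z))
  have h2 : Continuous fun g : SU11Cover => Real.log (1 - ‖(g.γ : ℂ)‖ ^ 2) :=
    Continuous.log (by fun_prop) fun g => (one_sub_pos g.γ).ne'
  unfold logFactor
  fun_prop

theorem continuous_multiplier (k : ℝ) (z : 𝔻) : Continuous fun g => multiplier k g z := by
  have := continuous_logFactor z
  unfold multiplier
  fun_prop

theorem continuous_moebius (z : 𝔻) : Continuous fun g => moebius g z := by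
  refine Complex.UnitDisc.isEmbedding_coe.continuous_iff.2 ?_
  change Continuous fun g : SU11Cover => (g.a * z + g.b) / (conj g.b * z + conj g.a)
  have ha : Continuous fun g : SU11Cover => conj g.a := Complex.continuous_conj.comp continuous_a
  have hb : Continuous fun g : SU11Cover => conj g.b := Complex.continuous_conj.comp continuous_b
  exact Continuous.div (by fun_prop) (by fun_prop) fun g => denom_ne_zero g z

/-! ### Transposition -/

theorem transpose_γ (g : SU11Cover) :
    ((transpose g).γ : ℂ) = exp (-2 * I * g.ω) * conj (g.γ : ℂ) := rfl

theorem transpose_ω (g : SU11Cover) : (transpose g).ω = g.ω := rfl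

theorem transpose_a (g : SU11Cover) : (transpose g).a = g.a := by
  rw [← proj_apply_zero_zero, coe_proj_transpose, Matrix.transpose_apply, proj_apply_zero_zero]

theorem transpose_b (g : SU11Cover) : (transpose g).b = conj g.b := by
  rw [← proj_apply_zero_one, coe_proj_transpose, Matrix.transpose_apply]
  rfl

/-- Needed for `transpose_mul`: matrices determine `ω` only modulo `2π`, and this equality settles
the `ω`-coordinate exactly. -/
theorem cocycle_transpose (g h : SU11Cover) :
    cocycle (transpose h) (transpose g) = cocycle g h := by
  have e : conj (exp (-2 * I * g.ω)) * exp (-2 * I * g.ω) = 1 := by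
    rw [mul_comm, mul_conj_eq, norm_exp_two]
    norm_num
  simp only [cocycle, transpose_γ, transpose_ω, map_mul, Complex.conj_conj]
  linear_combination (exp (-2 * I * h.ω) * conj (h.γ : ℂ) * g.γ) * e

theorem transpose_mul (g h : SU11Cover) :
    transpose (g * h) = transpose h * transpose g := by
  apply ext_a
  · rw [transpose_a, a_mul, a_mul]
    simp only [transpose_a, transpose_b, Complex.conj_conj]
    ring
  · rw [transpose_b, b_mul, b_mul]
    simp only [transpose_a, transpose_b, map_add, map_mul, Complex.conj_conj]
    ring
  · rw [transpose_ω, mul_ω, mul_ω, transpose_ω, transpose_ω, cocycle_transpose]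
    ring

theorem transpose_transpose (g : SU11Cover) : transpose (transpose g) = g := by
  apply ext_a
  · rw [transpose_a, transpose_a]
  · rw [transpose_b, transpose_b, Complex.conj_conj]
  · rfl

theorem continuous_transpose : Continuous transpose := by
  apply continuous_of_coordinates
  · simp only [transpose_γ]
    have : Continuous fun g : SU11Cover => conj (g.γ : ℂ) :=
      Complex.continuous_conj.comp continuous_coe_γ
    fun_prop
  · simp only [transpose_ω]
    fun_prop

/-- Transposition as a homomorphism onto the opposite group. -/
def transposeHom : SU11Cover →* SU11Coverᵐᵒᵖ where
  toFun g := MulOpposite.op (transpose g)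
  map_one' := by
    rw [← MulOpposite.op_one, MulOpposite.op_inj]
    apply ext_a
    · rw [transpose_a]
    · rw [transpose_b, b_one, map_zero]
    · rfl
  map_mul' g h := by rw [transpose_mul, MulOpposite.op_mul]

end SU11Cover

end

noncomputable section

/-! ### The reproducing kernel -/

theorem weight_zero (k : Param) : weight k 0 = 1 := by
  have h1 := Real.Gamma_pos_of_pos (s := 2 * k) (by linarith [k.2.1])
  simp [weight, h1.ne']

theorem weight_succ (k : Param) (n : ℕ) :
    weight k (n + 1) = weight k n * ((n + 1) / (2 * k + n)) := by
  have hk := k.2.1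
  have h0 : (0 : ℝ) < 2 * k + n := by positivity
  have h2 : Real.Gamma (((n + 1 : ℕ) : ℝ) + 1) = (n + 1) * Real.Gamma (n + 1) := by
    push_cast
    exact Real.Gamma_add_one (by positivity)
  have h3 : Real.Gamma (2 * k + ((n + 1 : ℕ) : ℝ)) = (2 * k + n) * Real.Gamma (2 * k + n) := by
    push_cast
    rw [← add_assoc]
    exact Real.Gamma_add_one h0.ne'
  rw [weight, h2, h3, weight]
  field_simp

theorem multichoose_succ_mul (r : ℂ) (n : ℕ) :
    Ring.multichoose r (n + 1) * (n + 1) = Ring.multichoose r n * (r + n) := by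
  have h (m : ℕ) : (m.factorial : ℂ) * Ring.multichoose r m = (ascPochhammer ℂ m).eval r := by
    rw [← nsmul_eq_mul, Ring.factorial_nsmul_multichoose_eq_ascPochhammer,
      ← Polynomial.ascPochhammer_smeval_eq_eval]
  have h1 := h (n + 1)
  rw [ascPochhammer_succ_eval, ← h n, Nat.factorial_succ] at h1
  push_cast at h1
  have h2 : (n.factorial : ℂ) ≠ 0 := by exact_mod_cast n.factorial_ne_zero
  exact mul_left_cancel₀ h2 (by linear_combination h1)

/-- Both sides start at `1` and satisfy `(n + 1) c (n + 1) = (2k + n) c n`. Hence the inverse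
weights are the coefficients of the binomial series of `(1 - x)^{-2k}`. -/
theorem inv_weight_eq_multichoose (k : Param) (n : ℕ) :
    ((weight k n : ℝ) : ℂ)⁻¹ = Ring.multichoose ((2 * k : ℝ) : ℂ) n := by
  induction n with
  | zero => simp [weight_zero]
  | succ n ih =>
    have hk := k.2.1
    have h0 : ((2 * k + n : ℝ) : ℂ) ≠ 0 := by
      exact_mod_cast (by positivity : (0 : ℝ) < 2 * k + n).ne'
    have h1 : (n + 1 : ℂ) ≠ 0 := by exact_mod_cast n.succ_ne_zero
    have h2 := multichoose_succ_mul ((2 * k : ℝ) : ℂ) n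
    rw [← ih] at h2
    rw [← mul_left_inj' h1, h2, weight_succ]
    push_cast at h0 ⊢
    rw [mul_inv, inv_div, mul_assoc, div_mul_cancel₀ _ h1]

theorem hasSum_inv_weight (k : Param) {x : ℂ} (hx : ‖x‖ < 1) :
    HasSum (fun n => ((weight k n : ℝ) : ℂ)⁻¹ * x ^ n) (exp (-2 * k * log (1 - x))) := by
  have h := (one_div_one_sub_cpow_hasFPowerSeriesOnBall_zero ((2 * k : ℝ) : ℂ)).hasSum
    (y := x) (by simpa [enorm_eq_nnnorm] using! hx)
  have hne : 1 - x ≠ 0 := by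
    rw [sub_eq_add_neg]
    exact SU11Cover.one_add_ne_zero (by rwa [norm_neg])
  rw [zero_add, cpow_def_of_ne_zero hne, one_div (exp _), ← Complex.exp_neg] at h
  have e : -2 * k * log (1 - x) = -(log (1 - x) * ((2 * k : ℝ) : ℂ)) := by
    push_cast
    ring
  rw [e]
  have e2 (n : ℕ) : FormalMultilinearSeries.ofScalars ℂ
      (fun n : ℕ => Ring.choose (((2 * k : ℝ) : ℂ) + n - 1) n) n (fun _ => x) =
        ((weight k n : ℝ) : ℂ)⁻¹ * x ^ n := by
    rw [inv_weight_eq_multichoose, Ring.multichoose_eq]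
    simp [FormalMultilinearSeries.ofScalars]
  simpa only [e2] using! h

namespace HolSpace

open SU11Cover

variable {k : Param}

theorem coeff_eq {f : HolSpace k} {a : ℕ → ℂ} (h : HasTaylor f a) : f.coeff = a :=
  (hasTaylor f).unique h

theorem ext_apply {f g : HolSpace k} (h : ∀ z, f z = g z) : f = g :=
  Subtype.ext (funext h)

theorem smul_apply (c : ℂ) (f : HolSpace k) (z : 𝔻) : (c • f) z = c * f z := rfl

theorem hasTaylor_kernel (w : 𝔻) :
    HasTaylor (fun z => exp (-2 * k * log (1 - conj (w : ℂ) * z)))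
      (fun n => ((weight k n : ℝ) : ℂ)⁻¹ * conj (w : ℂ) ^ n) := by
  intro z
  have h := hasSum_inv_weight k (norm_conj_mul_lt w z)
  simpa only [mul_pow, mul_assoc] using h

/-- The reproducing kernel `z ↦ (1 - conj w z)^{-2k}`. -/
def kernel (k : Param) (w : 𝔻) : HolSpace k :=
  ⟨fun z => exp (-2 * k * log (1 - conj (w : ℂ) * z)), _, hasTaylor_kernel w, by
    -- The terms are `|w|^{2n} / weight k n`, and the weights are at least `1`.
    refine Summable.of_nonneg_of_le (fun n => mul_nonneg (weight_pos k n).le (sq_nonneg _))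
      (fun n => ?_) (summable_geometric_of_lt_one (sq_nonneg _) w.sq_norm_lt_one)
    have h1 := weight_pos k n
    have h2 := weight_ge_one k n
    rw [norm_mul, norm_inv, norm_pow, Complex.norm_conj, Complex.norm_real,
      Real.norm_of_nonneg h1.le, mul_pow, ← pow_mul, mul_comm n, pow_mul]
    have h3 : weight k n * ((weight k n)⁻¹ ^ 2 * (‖(w : ℂ)‖ ^ 2) ^ n) =
        (weight k n)⁻¹ * (‖(w : ℂ)‖ ^ 2) ^ n := by
      field_simp
    rw [h3]
    exact mul_le_of_le_one_left (by positivity) (inv_le_one_of_one_le₀ h2)⟩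

theorem kernel_apply (w z : 𝔻) :
    kernel k w z = exp (-2 * k * log (1 - conj (w : ℂ) * z)) := rfl

theorem kernel_zero_apply (z : 𝔻) : kernel k 0 z = 1 := by
  simp [kernel_apply]

theorem coeff_kernel (w : 𝔻) :
    (kernel k w).coeff = fun n => ((weight k n : ℝ) : ℂ)⁻¹ * conj (w : ℂ) ^ n :=
  coeff_eq (hasTaylor_kernel w)

theorem inner_kernel_left (w : 𝔻) (f : HolSpace k) : inner ℂ (kernel k w) f = f w := by
  rw [inner_def, scalarProduct, coeff_kernel, ← (hasTaylor f w).tsum_eq]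
  congr 1
  funext n
  have h : ((weight k n : ℝ) : ℂ) ≠ 0 := by exact_mod_cast (weight_pos k n).ne'
  simp only [map_mul, map_inv₀, Complex.conj_ofReal, map_pow, Complex.conj_conj]
  field_simp

/-- By the reproducing property, a function orthogonal to all kernels vanishes at every point. -/
theorem span_kernel_topologicalClosure :
    (Submodule.span ℂ (Set.range (kernel k))).topologicalClosure = ⊤ := by
  rw [Submodule.topologicalClosure_eq_top_iff, Submodule.eq_bot_iff]
  intro f hf
  refine ext_apply fun w => ?_
  rw [← inner_kernel_left]
  exact (Submodule.mem_orthogonal _ _).1 hf _ (Submodule.subset_span ⟨w, rfl⟩)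

theorem eq_top_of_kernel_mem {V : Submodule ℂ (HolSpace k)} (hV : IsClosed (V : Set (HolSpace k)))
    (h : ∀ w, kernel k w ∈ V) : V = ⊤ := by
  rw [eq_top_iff, ← span_kernel_topologicalClosure]
  refine Submodule.topologicalClosure_minimal _ (Submodule.span_le.2 ?_) hV
  rintro _ ⟨w, rfl⟩
  exact h w

theorem denseRange_linearCombination_kernel :
    DenseRange (Finsupp.linearCombination ℂ (kernel k)) := by
  have h := span_kernel_topologicalClosure (k := k)
  rw [← Finsupp.range_linearCombination] at h
  exact dense_iff_closure_eq.2 (congrArg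
    (fun V : Submodule ℂ (HolSpace k) => (V : Set (HolSpace k))) h)

theorem continuous_kernel_apply {X : Type*} [TopologicalSpace X] {f h : X → 𝔻}
    (hf : Continuous f) (hh : Continuous h) : Continuous fun x => kernel k (f x) (h x) := by
  have hlog : Continuous fun x => log (1 - conj (f x : ℂ) * h x) := by
    refine Continuous.clog ?_ fun x =>
      mem_slitPlane_of_abs_arg_lt (one_sub_conj_mul_ne_zero (f x) (h x))
        (abs_arg_one_sub (f x) (h x))
    have h1 : Continuous fun x => conj (f x : ℂ) :=
      Complex.continuous_conj.comp (Complex.UnitDisc.continuous_coe.comp hf)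
    have h2 : Continuous fun x => (h x : ℂ) := Complex.UnitDisc.continuous_coe.comp hh
    fun_prop
  simp only [kernel_apply]
  fun_prop

/-- The reproducing property expands `‖kernel k z - kernel k w‖ ^ 2` into four kernel values, which
depend continuously on `z`. -/
theorem continuous_kernel : Continuous (kernel k) := by
  rw [continuous_iff_continuousAt]
  intro w
  have hn : Continuous fun z : 𝔻 => ‖kernel k z - kernel k w‖ := by
    have e : (fun z : 𝔻 => ‖kernel k z - kernel k w‖) = fun z =>
        √(kernel k z z - kernel k z w - (kernel k w z - kernel k w w)).re := by
      funext z
      rw [norm_eq_sqrt_re_inner (𝕜 := ℂ), inner_sub_right, inner_sub_left, inner_sub_left]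
      simp only [inner_kernel_left]
      rfl
    rw [e]
    have h1 := continuous_kernel_apply (k := k) (continuous_id (X := 𝔻)) continuous_id
    have h2 := continuous_kernel_apply (k := k) (continuous_id (X := 𝔻)) (continuous_const (y := w))
    have h3 := continuous_kernel_apply (k := k) (continuous_const (y := w)) (continuous_id (X := 𝔻))
    simp only [id] at h1 h2 h3
    fun_prop
  rw [ContinuousAt, tendsto_iff_norm_sub_tendsto_zero]
  simpa using hn.tendsto w

end HolSpace

end

noncomputable section

/-! ### The representation -/

/-- The norm of a finite combination depends only on the Gram matrix. Thus an assignment of vectors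
that preserves inner products extends to the closed span. -/
theorem norm_linearCombination_eq {ι E : Type*} [NormedAddCommGroup E] [InnerProductSpace ℂ E]
    {u v : ι → E} (h : ∀ i j, inner ℂ (u i) (u j) = inner ℂ (v i) (v j)) (x : ι →₀ ℂ) :
    ‖Finsupp.linearCombination ℂ u x‖ = ‖Finsupp.linearCombination ℂ v x‖ := by
  rw [norm_eq_sqrt_re_inner (𝕜 := ℂ), norm_eq_sqrt_re_inner (𝕜 := ℂ)]
  simp only [Finsupp.linearCombination_apply, Finsupp.sum, sum_inner, inner_sum, inner_smul_left,
    inner_smul_right, h]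

namespace HolSpace

open SU11Cover

variable {k : Param}

/-- The image of the kernel at `w` under the adjoint of the operator of `g`. -/
def movedKernel (k : Param) (g : SU11Cover) (w : 𝔻) : HolSpace k :=
  conj (multiplier k g w) • kernel k (g.moebius w)

theorem inner_movedKernel_left (g : SU11Cover) (w : 𝔻) (f : HolSpace k) :
    inner ℂ (movedKernel k g w) f = multiplier k g w * f (g.moebius w) := by
  rw [movedKernel, inner_smul_left, Complex.conj_conj, inner_kernel_left]

theorem inner_movedKernel (g : SU11Cover) (w z : 𝔻) :
    inner ℂ (movedKernel k g z) (movedKernel k g w) = inner ℂ (kernel k z) (kernel k w) := by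
  rw [inner_movedKernel_left, inner_kernel_left, movedKernel, smul_apply, kernel_apply,
    kernel_apply, ← log_one_sub_moebius g w z, multiplier, multiplier, ← Complex.exp_conj,
    ← Complex.exp_add, ← Complex.exp_add]
  congr 1
  simp only [map_mul, map_neg, Complex.conj_ofReal, map_ofNat]
  ring

/-- The contraction that maps `kernel k w` to `movedKernel k g w`. -/
def adjointOperator (k : Param) (g : SU11Cover) : HolSpace k →L[ℂ] HolSpace k :=
  (Finsupp.linearCombination ℂ (movedKernel k g)).extendOfNorm
    (Finsupp.linearCombination ℂ (kernel k))

theorem norm_linearCombination_movedKernel_le (g : SU11Cover) (x : 𝔻 →₀ ℂ) :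
    ‖Finsupp.linearCombination ℂ (movedKernel k g) x‖ ≤
      1 * ‖Finsupp.linearCombination ℂ (kernel k) x‖ := by
  rw [one_mul]
  exact (norm_linearCombination_eq (fun i j => inner_movedKernel g j i) x).le

theorem adjointOperator_kernel (g : SU11Cover) (w : 𝔻) :
    adjointOperator k g (kernel k w) = movedKernel k g w := by
  have h := LinearMap.extendOfNorm_eq (denseRange_linearCombination_kernel (k := k))
    ⟨1, norm_linearCombination_movedKernel_le g⟩ (Finsupp.single w 1)
  simpa using! h

theorem norm_adjointOperator_le (g : SU11Cover) : ‖adjointOperator k g‖ ≤ 1 :=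
  ContinuousLinearMap.opNorm_le_bound _ zero_le_one
    (LinearMap.norm_extendOfNorm_apply_le denseRange_linearCombination_kernel 1
      (norm_linearCombination_movedKernel_le g))

/-- The operator of `g`. -/
def operator (k : Param) (g : SU11Cover) : HolSpace k →L[ℂ] HolSpace k :=
  ContinuousLinearMap.adjoint (adjointOperator k g)

/-- Evaluation at `z` is pairing with the kernel, and the adjoint moves the operator onto that
kernel. In particular the weighted composition belongs to the space because it is the value of an
operator there. -/
theorem operator_apply (g : SU11Cover) (f : HolSpace k) (z : 𝔻) :
    operator k g f z = multiplier k g z * f (g.moebius z) := by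
  rw [← inner_kernel_left, operator, ContinuousLinearMap.adjoint_inner_right,
    adjointOperator_kernel, inner_movedKernel_left]

theorem norm_operator_apply_le (g : SU11Cover) (f : HolSpace k) : ‖operator k g f‖ ≤ ‖f‖ := by
  have h := (operator k g).le_opNorm f
  rw [operator, LinearIsometryEquiv.norm_map] at h
  exact h.trans (mul_le_of_le_one_left (norm_nonneg _) (norm_adjointOperator_le g))

theorem operator_mul (g h : SU11Cover) (f : HolSpace k) :
    operator k (g * h) f = operator k h (operator k g f) := by
  refine ext_apply fun z => ?_
  rw [operator_apply, operator_apply, operator_apply, multiplier_mul, moebius_mul, mul_assoc]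

theorem operator_one (f : HolSpace k) : operator k 1 f = f := by
  refine ext_apply fun z => ?_
  rw [operator_apply, multiplier_one, moebius_one, one_mul]

theorem operator_inv_operator (g : SU11Cover) (f : HolSpace k) :
    operator k g⁻¹ (operator k g f) = f := by
  rw [← operator_mul, mul_inv_cancel, operator_one]

theorem operator_operator_inv (g : SU11Cover) (f : HolSpace k) :
    operator k g (operator k g⁻¹ f) = f := by
  rw [← operator_mul, inv_mul_cancel, operator_one]

/-- The operator of `g` as a unitary operator. -/
def unitaryOperator (k : Param) (g : SU11Cover) : HolSpace k ≃ₗᵢ[ℂ] HolSpace k :=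
  LinearIsometryEquiv.ofSurjective
    { toLinearMap := (operator k g).toLinearMap
      -- The operator of `g⁻¹` is a contraction that undoes this one, which gives the reverse
      -- inequality.
      norm_map' := fun f => le_antisymm (norm_operator_apply_le g f) (by
        have h := norm_operator_apply_le g⁻¹ (operator k g f)
        rwa [operator_inv_operator] at h) }
    fun f => ⟨operator k g⁻¹ f, operator_operator_inv g f⟩

theorem unitaryOperator_apply (g : SU11Cover) (f : HolSpace k) :
    unitaryOperator k g f = operator k g f := rfl

/-- The representation of the opposite group. -/
def rep (k : Param) : SU11Coverᵐᵒᵖ →* (HolSpace k ≃ₗᵢ[ℂ] HolSpace k) where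
  toFun g := unitaryOperator k g.unop
  map_one' := by
    ext1 f
    rw [unitaryOperator_apply, MulOpposite.unop_one, operator_one]
    rfl
  map_mul' g h := by
    ext1 f
    rw [unitaryOperator_apply, MulOpposite.unop_mul, operator_mul]
    rfl

theorem rep_apply (g : SU11Coverᵐᵒᵖ) (f : HolSpace k) (z : 𝔻) :
    rep k g f z = multiplier k g.unop z * f (g.unop.moebius z) :=
  operator_apply g.unop f z

/-! ### Adjoints, orbits of the kernels and strong continuity. -/

theorem inner_rep_left (g : SU11Coverᵐᵒᵖ) (f₁ f₂ : HolSpace k) :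
    inner ℂ (rep k g f₁) f₂ = inner ℂ f₁ (rep k g⁻¹ f₂) := by
  have h : rep k g⁻¹ (rep k g f₁) = f₁ := operator_inv_operator g.unop f₁
  rw [← (rep k g⁻¹).inner_map_map (rep k g f₁) f₂, h]

theorem rep_kernel (g : SU11Coverᵐᵒᵖ) (w : 𝔻) :
    rep k g (kernel k w) = movedKernel k g.unop⁻¹ w := by
  refine ext_inner_right ℂ fun f => ?_
  rw [inner_rep_left, inner_kernel_left, inner_movedKernel_left, rep_apply]
  rfl

/-- The vectors with continuous orbit map form a closed subspace, and it contains the kernels by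
`rep_kernel`. -/
theorem continuous_rep (f : HolSpace k) : Continuous fun g => rep k g f := by
  let V : Submodule ℂ (HolSpace k) :=
    { carrier := {f | Continuous fun g => rep k g f}
      zero_mem' := by
        simp only [Set.mem_ofPred_eq, map_zero]
        exact continuous_const
      add_mem' := fun {f g} hf hg => by
        simp only [Set.mem_ofPred_eq, map_add] at hf hg ⊢
        exact hf.add hg
      smul_mem' := fun c f hf => by
        simp only [Set.mem_ofPred_eq, map_smul] at hf ⊢
        exact hf.const_smul c }
  have hV : IsClosed (V : Set (HolSpace k)) := by
    -- The operators are isometries, so approximating `f` approximates its orbit map uniformly in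
    -- `g`.
    refine isClosed_of_closure_subset fun f hf => ?_
    refine continuous_of_uniform_approx_of_continuous fun u hu => ?_
    obtain ⟨ε, hε, hεu⟩ := Metric.mem_uniformity_dist.1 hu
    obtain ⟨h, hh, hd⟩ := Metric.mem_closure_iff.1 hf ε hε
    exact ⟨fun g => rep k g h, hh, fun g => hεu (by rwa [LinearIsometryEquiv.dist_map])⟩
  have htop : V = ⊤ := by
    refine eq_top_of_kernel_mem hV fun w => ?_
    change Continuous fun g => rep k g (kernel k w)
    simp only [rep_kernel, movedKernel]
    have hinv : Continuous fun g : SU11Coverᵐᵒᵖ => g.unop⁻¹ := MulOpposite.continuous_unop.inv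
    exact (Complex.continuous_conj.comp ((continuous_multiplier k w).comp hinv)).smul
      (continuous_kernel.comp ((continuous_moebius w).comp hinv))
  have hf : f ∈ V := htop ▸ Submodule.mem_top
  exact hf

/-! ### Irreducibility -/

theorem exists_moebius_zero (w : 𝔻) : ∃ g : SU11Cover, g.moebius 0 = w := by
  -- With `ω = 0` the entry `a` is real, so `0` goes to `b / conj a = γ`.
  let g : SU11Cover := ⟨w, 0⟩
  refine ⟨g, Complex.UnitDisc.coe_injective ?_⟩
  have h0 : conj g.a = g.a := by
    rw [conj_a]
    simp [g]
  have h1 := a_ne_zero g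
  rw [coe_moebius, Complex.UnitDisc.coe_zero, mul_zero, mul_zero, zero_add, zero_add, h0, b_eq,
    mul_div_cancel_left₀ _ h1]

/-- The constant function `1` is a cyclic vector. -/
theorem eq_top_of_kernel_zero_mem {V : Submodule ℂ (HolSpace k)}
    (hV : IsClosed (V : Set (HolSpace k))) (hinv : ∀ g, ∀ v ∈ V, rep k g v ∈ V)
    (h : kernel k 0 ∈ V) : V = ⊤ := by
  refine eq_top_of_kernel_mem hV fun w => ?_
  obtain ⟨g, rfl⟩ := exists_moebius_zero w
  have h1 := hinv (MulOpposite.op g⁻¹) _ h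
  rw [rep_kernel, MulOpposite.unop_op, inv_inv, movedKernel] at h1
  exact (V.smul_mem_iff ((map_ne_zero _).2 (multiplier_ne_zero k g 0))).1 h1

/-- The rotation `z ↦ e^{2iω} z`. -/
def rotation (ω : ℝ) : SU11Cover := ⟨0, ω⟩

theorem coe_moebius_rotation (ω : ℝ) (z : 𝔻) :
    ((rotation ω).moebius z : ℂ) = exp (2 * I * ω) * z := by
  have ha : (rotation ω).a = exp (I * ω) := by simp [a, rotation]
  have hb : (rotation ω).b = 0 := by simp [b, rotation]
  rw [coe_moebius, ha, hb, conj_exp_I, Complex.exp_neg, map_zero, zero_mul, zero_add, add_zero,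
    div_inv_eq_mul, mul_right_comm, ← Complex.exp_add]
  ring_nf

theorem multiplier_rotation (ω : ℝ) (z : 𝔻) :
    multiplier k (rotation ω) z = multiplier k (rotation ω) 0 := by
  simp [multiplier, logFactor, rotation]

theorem eq_smul_kernel_zero_of_rotation_invariant {f : HolSpace k}
    (h : ∀ (ω : ℝ) (z : 𝔻), f ((rotation ω).moebius z) = f z) :
    f = f.coeff 0 • kernel k 0 := by
  have hc (ω : ℝ) (n : ℕ) : f.coeff n * exp (2 * I * ω) ^ n = f.coeff n := by
    have hT : HasTaylor f (fun n => f.coeff n * exp (2 * I * ω) ^ n) := fun z => by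
      have h1 := hasTaylor f ((rotation ω).moebius z)
      rw [h, coe_moebius_rotation] at h1
      simpa only [mul_pow, mul_assoc] using h1
    exact congrFun (hT.unique (hasTaylor f)) n
  have hc0 (n : ℕ) : f.coeff (n + 1) = 0 := by
    -- This angle gives `e^{2iω(n+1)} = e^{iπ} = -1`, so the coefficient equals its own negative.
    have h1 := hc (Real.pi / (2 * (n + 1))) (n + 1)
    have h2 : exp (2 * I * (Real.pi / (2 * (n + 1)) : ℝ)) ^ (n + 1) = -1 := by
      rw [← Complex.exp_nat_mul, ← Complex.exp_pi_mul_I]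
      congr 1
      have : (n + 1 : ℂ) ≠ 0 := by exact_mod_cast n.succ_ne_zero
      push_cast
      field_simp
    rw [h2] at h1
    linear_combination -(1 / 2) * h1
  apply ext_coeff
  rw [coeff_smul, coeff_kernel]
  funext n
  cases n with
  | zero => simp [weight_zero]
  | succ n => simp [hc0]

/-- The constant `1` is an eigenvector of the rotations, and the constants are the only
rotation-invariant functions. Its component `p` in `V` is therefore a constant, and according as `p`
is zero or not, the cyclic vector `1` lies in `Vᗮ` or in `V`. -/
theorem rep_irreducible (V : Submodule ℂ (HolSpace k)) (hV : IsClosed (V : Set (HolSpace k)))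
    (hinv : ∀ g, ∀ v ∈ V, rep k g v ∈ V) : V = ⊥ ∨ V = ⊤ := by
  have : CompleteSpace V := hV.completeSpace_coe
  have hinv' : ∀ g, ∀ v ∈ Vᗮ, rep k g v ∈ Vᗮ := by
    intro g v hv
    rw [Submodule.mem_orthogonal']
    intro u hu
    rw [inner_rep_left]
    exact (Submodule.mem_orthogonal' _ _).1 hv _ (hinv _ u hu)
  obtain ⟨p, hp, q, hq, hpq⟩ := Submodule.exists_add_mem_mem_orthogonal (K := V) (kernel k 0)
  have hrot (ω : ℝ) (z : 𝔻) : p ((rotation ω).moebius z) = p z := by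
    set c := multiplier k (rotation ω) 0 with hc
    have h1 : rep k (MulOpposite.op (rotation ω)) (kernel k 0) = c • kernel k 0 := by
      refine ext_apply fun z => ?_
      rw [rep_apply, smul_apply, kernel_zero_apply, kernel_zero_apply, MulOpposite.unop_op,
        multiplier_rotation]
    rw [hpq, map_add, smul_add] at h1
    set P := rep k (MulOpposite.op (rotation ω)) p with hP
    set Q := rep k (MulOpposite.op (rotation ω)) q with hQ
    -- Uniqueness of the orthogonal decomposition: the component `p` inherits the eigenvalue `c` of
    -- `1`.
    have h2 : P - c • p ∈ V := V.sub_mem (hinv _ p hp) (V.smul_mem c hp)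
    have h3 : P - c • p ∈ Vᗮ := by
      have e : P - c • p = c • q - Q := by
        rw [sub_eq_sub_iff_add_eq_add, h1, add_comm]
      rw [e]
      exact Vᗮ.sub_mem (Vᗮ.smul_mem c hq) (hinv' _ q hq)
    have h4 : P - c • p = 0 := by
      have := V.inf_orthogonal_eq_bot ▸ Submodule.mem_inf.2 ⟨h2, h3⟩
      simpa using this
    have h5 : P z = (c • p) z := by rw [sub_eq_zero.1 h4]
    -- The multiplier of a rotation is a nonzero constant equal to `c`, so it cancels and plain
    -- invariance of `p` remains.
    rw [hP, rep_apply, smul_apply, MulOpposite.unop_op, multiplier_rotation] at h5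
    exact mul_left_cancel₀ (multiplier_ne_zero k _ 0) h5
  have hpc := eq_smul_kernel_zero_of_rotation_invariant hrot
  by_cases hc : p.coeff 0 = 0
  · left
    rw [hc, zero_smul] at hpc
    rw [hpc, zero_add] at hpq
    have h1 := eq_top_of_kernel_zero_mem V.isClosed_orthogonal hinv' (hpq ▸ hq)
    rwa [Submodule.orthogonal_eq_top_iff] at h1
  · right
    rw [hpc] at hp
    exact eq_top_of_kernel_zero_mem hV hinv ((V.smul_mem_iff hc).1 hp)

instance : Nontrivial (HolSpace k) :=
  ⟨kernel k 0, 0, fun h => by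
    have h1 := kernel_zero_apply (k := k) 0
    rw [h] at h1
    exact zero_ne_one h1⟩

/-! ### The representations of the opposite group and of the group itself. -/

theorem isContinuousIrreducible_rep : IsContinuousIrreducible (rep k) where
  continuous := continuous_rep
  nontrivial := inferInstance
  irreducible := rep_irreducible

/-- Transposition is an involution, so the same operators occur and the invariant subspaces are
unchanged. -/
theorem isContinuousIrreducible_rep_transpose :
    IsContinuousIrreducible ((rep k).comp transposeHom) where
  continuous v := (continuous_rep v).comp (MulOpposite.continuous_op.comp continuous_transpose)
  nontrivial := inferInstance
  irreducible V hV hinv := rep_irreducible V hV fun g v hv => by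
    have h := hinv (transpose g.unop) v hv
    change rep k (MulOpposite.op (transpose (transpose g.unop))) v ∈ V at h
    rwa [transpose_transpose] at h

end HolSpace

end

theorem mainTheorem3 (k : Set.Ioo (0 : ℝ) (1 / 2)) :
    -- the coordinates `(γ, ω)` describe the universal covering group of `SU(1,1)`
    (IsTopologicalGroup SU11Cover ∧ SimplyConnectedSpace SU11Cover ∧
      IsCoveringMap SU11Cover.proj ∧ Function.Surjective SU11Cover.proj) ∧
    -- the formula defines a representation of the opposite group
    ∃ T : SU11Coverᵐᵒᵖ →* (HolSpace k ≃ₗᵢ[ℂ] HolSpace k),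
      (∀ (g : SU11Cover) (f : HolSpace k) (z : Complex.UnitDisc),
        T (MulOpposite.op g) f z = repFormula k g f z) ∧
      IsContinuousIrreducible T ∧
      (∀ (g : SU11Cover) (f₁ f₂ : HolSpace k),
        inner ℂ (T (MulOpposite.op g) f₁) f₂ = inner ℂ f₁ (T (MulOpposite.op g⁻¹) f₂)) ∧
      -- hence, after transposition, one of the group itself
      ∃ U : SU11Cover →* (HolSpace k ≃ₗᵢ[ℂ] HolSpace k),
        (∀ g : SU11Cover, U g = T (MulOpposite.op g.transpose)) ∧
        IsContinuousIrreducible U :=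
  ⟨⟨inferInstance, inferInstance, SU11Cover.isCoveringMap_proj, SU11Cover.proj_surjective⟩,
    HolSpace.rep k,
    fun g f z => by rw [HolSpace.rep_apply, repFormula_eq, MulOpposite.unop_op],
    HolSpace.isContinuousIrreducible_rep,
    fun g f₁ f₂ => HolSpace.inner_rep_left (MulOpposite.op g) f₁ f₂,
    (HolSpace.rep k).comp SU11Cover.transposeHom, fun _ => rfl,
    HolSpace.isContinuousIrreducible_rep_transpose⟩
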